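/- Let $V$ be a vertex operator algebra over $\mathbb{C}$, $G$ a group of automorphisms of $V$ and $z\in\mathbb{C}^{\times}$. For $g\in G$, a $g$-twisted $V$-module means a lower-bounded generalized $g$-twisted $V$-module $W=\coprod_{n\in\mathbb{C}}W_{[n]}$; write $W'=\coprod_n W_{[n]}^{*}$ for its contragredient, a $g^{-1}$-twisted module with vertex operator map $\langle Y'(v,x)w',w\rangle=\langle w',Y(e^{xL(1)}(-x^{-2})^{L(0)}v,x^{-1})w\rangle$, and $\overline{W}=\prod_n W_{[n]}$. Let $\mathcal{C}$ be a category whose objects form a class of $g$-twisted $V$-modules, $g\in G$, either all considered without $g$-actions or all equipped with an action of $G$ (extending a $g$-action), and whose morphisms are all $V$-module maps between modules twisted by the same $g$, i.e. the linear maps commuting with the twisted vertex operators. For a $g_1$-twisted $W_1$ and a $g_2$-twisted $W_2$ in $\mathcal{C}$, a $P(z)$-product is a pair $(W_3,I)$ of a $g_1g_2$-twisted module $W_3$ in $\mathcal{C}$ and a linear map $I:W_1\otimes W_2\to\overline{W_3}$ of the form $I(w_1\otimes w_2)=\mathcal{Y}(w_1,z)w_2$, with $\mathcal{Y}$ a twisted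 intertwining operator of type $\binom{W_3}{W_1W_2}$ and $\log z=\log|z|+i\arg z$, $0\le\arg z<2\pi$. For $w_3'\in W_3'$ let $\lambda_{I,w_3'}=\langle w_3',I(\cdot)\rangle\in(W_1\otimes W_2)^*$, and let $W_1\boxbackslash_{P(z)}W_2\subset(W_1\otimes W_2)^*$ be the span of all these functionals, graded so that $w_3'\mapsto\lambda_{I,w_3'}$ preserves weights and with vertex operator map $Y(v,x)\lambda_{I,w_3'}=\lambda_{I,Y_{W_3'}(v,x)w_3'}$. Assume that 1. for all $W_1,W_2$ in $\mathcal{C}$, $W_1\boxbackslash_{P(z)}W_2$ is (as a $(g_1g_2)^{-1}$-twisted module) in $\mathcal{C}$, with some action of $G$ if the objects of $\mathcal{C}$ carry $G$-actions; 2. the contragredient of every object of $\mathcal{C}$ is in $\mathcal{C}$; 3. the double contragredient of every object of $\mathcal{C}$ is equivalent to the object itself. Set $W_1\boxtimes_{P(z)}W_2=(W_1\boxbackslash_{P(z)}W_2)'$, an object of $\mathcal{C}$, and let $\boxtimes_{P(z)}:W_1\otimes W_2\to\overline{W_1\boxtimes_{P(z)}W_2}$, $w_1\otimes w_2\mapsto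 w_1\boxtimes_{P(z)}w_2$, be the map determined by $\langle\lambda,w_1\boxtimes_{P(z)}w_2\rangle=\lambda(w_1\otimes w_2)$ for $\lambda\in W_1\boxbackslash_{P(z)}W_2$. Then it has the universal property of the $P(z)$-tensor product: for every $P(z)$-product $(W_3,I)$ of $W_1$ and $W_2$ there is a unique module map $f:W_1\boxtimes_{P(z)}W_2\to W_3$ whose natural extension $\bar f$ to the completions satisfies $\bar f\circ\boxtimes_{P(z)}=I$. For all morphisms $f_1:W_1\to\widetilde W_1$ and $f_2:W_2\to\widetilde W_2$ of $\mathcal{C}$ there is a unique module map $f_1\boxtimes_{P(z)}f_2:W_1\boxtimes_{P(z)}W_2\to\widetilde W_1\boxtimes_{P(z)}\widetilde W_2$ with $$\overline{f_1\boxtimes_{P(z)}f_2}\,(w_1\boxtimes_{P(z)}w_2)=f_1(w_1)\boxtimes_{P(z)}f_2(w_2)\qquad(w_1\in W_1,\ w_2\in W_2),$$ and the assignments $(W_1,W_2)\mapsto W_1\boxtimes_{P(z)}W_2$, $(f_1,f_2)\mapsto f_1\boxtimes_{P(z)}f_2$ are a functor $\mathcal{C}\times\mathcal{C}\to\mathcal{C}$.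 -/

import Mathlib

open scoped TensorProduct Topology

universe u v

noncomputable section

/-! ### Branches of the logarithm and multivalued analytic functions -/

/-- The argument of `z` normalised by `0 ≤ arg z < 2π`. -/
def argPos (z : ℂ) : ℝ := toIcoMod Real.two_pi_pos 0 (Complex.arg z)

/-- `l_p(z) = log |z| + i arg z + 2 π p i` with `0 ≤ arg z < 2π`. -/
def logBranch (p : ℤ) (z : ℂ) : ℂ :=
  (Real.log ‖z‖ : ℂ) + (argPos z : ℂ) * Complex.I + 2 * (Real.pi : ℂ) * (p : ℂ) * Complex.I

/-- The value of the formal monomial `x^{-n-1} (log x)^k` under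
`x^a = e^{a l_p(z)}`, `log x = l_p(z)`. -/
def monomialAt (p : ℤ) (n : ℂ) (k : ℕ) (z : ℂ) : ℂ :=
  Complex.exp ((-n - 1) * logBranch p z) * logBranch p z ^ k

/-- `H` is an analytic continuation along the path `γ`: for each `t` the function `H t` represents
an analytic germ at `γ t`, and the germs at nearby parameters are restrictions of one another. -/
structure IsContinuationAlong {n : ℕ} (γ : C(unitInterval, Fin n → ℂ))
    (H : unitInterval → (Fin n → ℂ) → ℂ) : Prop where
  analytic : ∀ t, AnalyticAt ℂ (H t) (γ t)
  coherent : ∀ t, ∀ᶠ s in 𝓝 t, H s =ᶠ[𝓝 (γ s)] H t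

/-- The germ of `h₁` at `x₁` is obtained from the germ of `h₀` at `x₀` by analytic continuation along
some path in `Ω`. -/
def ContinuesTo {n : ℕ} (Ω : Set (Fin n → ℂ)) (x₀ : Fin n → ℂ) (h₀ : (Fin n → ℂ) → ℂ)
    (x₁ : Fin n → ℂ) (h₁ : (Fin n → ℂ) → ℂ) : Prop :=
  ∃ (γ : C(unitInterval, Fin n → ℂ)) (H : unitInterval → (Fin n → ℂ) → ℂ),
    IsContinuationAlong γ H ∧ (∀ t, γ t ∈ Ω) ∧ γ 0 = x₀ ∧ γ 1 = x₁ ∧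
      H 0 =ᶠ[𝓝 x₀] h₀ ∧ H 1 =ᶠ[𝓝 x₁] h₁

/-- The germ of `h₀` at `x₀` extends to a multivalued analytic function on `Ω`: it can be continued
analytically along every path in `Ω` that starts at `x₀`. -/
structure ExtendsToMultivalued {n : ℕ} (Ω : Set (Fin n → ℂ)) (x₀ : Fin n → ℂ)
    (h₀ : (Fin n → ℂ) → ℂ) : Prop where
  analytic : AnalyticAt ℂ h₀ x₀
  continues : ∀ γ : C(unitInterval, Fin n → ℂ), γ 0 = x₀ → (∀ t, γ t ∈ Ω) →
    ∃ H, IsContinuationAlong γ H ∧ H 0 =ᶠ[𝓝 x₀] h₀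

/-- For points `z'` close to `z`: `z'` is not separated from `z` by the cuts `ℓ i ∈ ℝ₊`, where each
cut is attached to the upper half plane of `ℓ i`. -/
def SameSide {n r : ℕ} (ℓ : Fin r → (Fin n → ℂ) → ℂ) (z z' : Fin n → ℂ) : Prop :=
  ∀ i, |argPos (ℓ i z') - argPos (ℓ i z)| < Real.pi

/-- `f` is single-valued analytic on `S` cut along the `ℓ i ∈ ℝ₊`, with the cuts attached to the
upper half planes (so the values on a cut are the limits from above). -/
def IsCutBranch {n r : ℕ} (S : Set (Fin n → ℂ)) (ℓ : Fin r → (Fin n → ℂ) → ℂ)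
    (f : (Fin n → ℂ) → ℂ) : Prop :=
  ∀ z ∈ S, ∃ h, AnalyticAt ℂ h z ∧ ∀ᶠ z' in 𝓝 z, SameSide ℓ z z' → f z' = h z'

/-- The region `M^n`: all `z i ≠ 0` and `z i ≠ z j` for `i ≠ j`. -/
def configSpace (n : ℕ) : Set (Fin n → ℂ) :=
  {z | (∀ i, z i ≠ 0) ∧ ∀ i j, i ≠ j → z i ≠ z j}

/-- The linear forms `z₁`, `z₂`, `z₁ - z₂` whose positive real values are the cuts defining
`M^2_0`. -/
def cutForms : Fin 3 → (Fin 2 → ℂ) → ℂ :=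
  ![fun z => z 0, fun z => z 1, fun z => z 0 - z 1]

/-- `f` is the preferred single-valued branch on `M^2_0` of a multivalued analytic function
on `M^2`. -/
structure IsPreferredBranch (f : (Fin 2 → ℂ) → ℂ) : Prop where
  branch : IsCutBranch (configSpace 2) cutForms f
  extends_all : ∀ z ∈ configSpace 2, (∀ i, argPos (cutForms i z) ≠ 0) →
    ExtendsToMultivalued (configSpace 2) z f

/-- The punctured polydisc `Δ^×(δ, r)` for `δ ∈ {0, ∞}^n`, where `δ i = true` stands for `∞`. -/
def puncturedPolydisc {n : ℕ} (δ : Fin n → Bool) (r : Fin n → ℝ) : Set (Fin n → ℂ) :=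
  {ζ | ∀ i, if δ i then r i < ‖ζ i‖ else 0 < ‖ζ i‖ ∧ ‖ζ i‖ < r i}

/-- The point `z` with `z A - β = ζ` (row vectors). -/
def oldCoords {n : ℕ} (A : GL (Fin n) ℂ) (β ζ : Fin n → ℂ) : Fin n → ℂ :=
  Matrix.vecMul (ζ + β) (A⁻¹ : GL (Fin n) ℂ).1

/-- `ζ = z A - β = δ` is a component-isolated singularity of functions on `Ω`. -/
def IsComponentIsolated {n : ℕ} (Ω : Set (Fin n → ℂ)) (A : GL (Fin n) ℂ) (β : Fin n → ℂ)
    (δ : Fin n → Bool) : Prop :=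
  ∃ r : Fin n → ℝ, (∀ i, 0 < r i) ∧ ∀ ζ ∈ puncturedPolydisc δ r, oldCoords A β ζ ∈ Ω

/-- `φ`, a function of `ζ = z A - β`, is on `Δ^×(δ, r)` a single-valued branch, with cuts at
`ζ i ∈ ℝ₊`, of the multivalued function on `Ω` generated by the germ of `h₀` at `x₀`. -/
def IsBranchNear {n : ℕ} (Ω : Set (Fin n → ℂ)) (x₀ : Fin n → ℂ) (h₀ : (Fin n → ℂ) → ℂ)
    (A : GL (Fin n) ℂ) (β : Fin n → ℂ) (δ : Fin n → Bool) (r : Fin n → ℝ)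
    (φ : (Fin n → ℂ) → ℂ) : Prop :=
  ∀ ζ ∈ puncturedPolydisc δ r, ∃ h, ContinuesTo Ω x₀ h₀ (oldCoords A β ζ) h ∧
    ∀ᶠ ζ' in 𝓝 ζ, SameSide (fun i (x : Fin n → ℂ) => x i) ζ ζ' → φ ζ' = h (oldCoords A β ζ')

/-- `ζ = z A - β = δ` is a regular singularity of the multivalued function on `Ω` generated by the
germ of `h₀` at `x₀`: near `δ` every branch is the sum of an absolutely convergent series in the
`ζ i ^ a (log ζ i) ^ j`, with `j ≤ K` and `a` in a finite union of sets `s + ℕ` (if `δ i = 0`)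
or `s - ℕ` (if `δ i = ∞`). -/
def IsRegularSingularity {n : ℕ} (Ω : Set (Fin n → ℂ)) (x₀ : Fin n → ℂ)
    (h₀ : (Fin n → ℂ) → ℂ) (A : GL (Fin n) ℂ) (β : Fin n → ℂ) (δ : Fin n → Bool) : Prop :=
  ∃ (K : ℕ) (D : Fin n → Finset ℂ), ∀ (r : Fin n → ℝ) (φ : (Fin n → ℂ) → ℂ),
    (∀ i, 0 < r i) → (∀ ζ ∈ puncturedPolydisc δ r, oldCoords A β ζ ∈ Ω) →
    IsBranchNear Ω x₀ h₀ A β δ r φ →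
    ∃ (r' : Fin n → ℝ) (α : (Fin n → ℂ) → (Fin n → ℕ) → ℂ), (∀ i, 0 < r' i) ∧
      (∀ a j, α a j ≠ 0 → ∀ i, j i ≤ K ∧ ∃ s ∈ D i, ∃ l : ℕ,
        a i = if δ i then s - (l : ℂ) else s + (l : ℂ)) ∧
      ∀ ζ ∈ puncturedPolydisc δ r ∩ puncturedPolydisc δ r',
        HasSum (fun q : (Fin n → ℂ) × (Fin n → ℕ) => α q.1 q.2 *
          ∏ i, (Complex.exp (q.1 i * logBranch 0 (ζ i)) * logBranch 0 (ζ i) ^ q.2 i)) (φ ζ)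

/-! ### Graded vector spaces -/

theorem coeLinearMap_bijective {ι W : Type*} [DecidableEq ι] [AddCommGroup W] [Module ℂ W]
    {gr : ι → Submodule ℂ W} (h : DirectSum.IsInternal gr) :
    Function.Bijective (DirectSum.coeLinearMap gr) := h

/-- The projection of a direct sum onto one of its summands. -/
def gradedProj {ι W : Type*} [DecidableEq ι] [AddCommGroup W] [Module ℂ W]
    (gr : ι → Submodule ℂ W) (h : DirectSum.IsInternal gr) (n : ι) : W →ₗ[ℂ] W :=
  (gr n).subtype ∘ₗ DirectSum.component ℂ ι (fun i => gr i) n ∘ₗ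
    (LinearEquiv.ofBijective (DirectSum.coeLinearMap gr) (coeLinearMap_bijective h)).symm.toLinearMap

/-- A `ℂ`-graded complex vector space. -/
structure GradedSpace : Type (u + 1) where
  carrier : Type u
  [addCommGroup : AddCommGroup carrier]
  [module : Module ℂ carrier]
  gr : ℂ → Submodule ℂ carrier
  internal : DirectSum.IsInternal gr

attribute [instance] GradedSpace.addCommGroup GradedSpace.module

namespace GradedSpace

instance : CoeSort GradedSpace.{u} (Type u) := ⟨GradedSpace.carrier⟩

/-- The projection `π_n` onto the subspace of weight `n`. -/
def proj (W : GradedSpace.{u}) (n : ℂ) : W →ₗ[ℂ] W := gradedProj W.gr W.internal n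

/-- The algebraic completion `∏ W_[n]`. -/
abbrev Completion (W : GradedSpace.{u}) : Type u := (n : ℂ) → W.gr n

/-- The graded dual `W' = ∐ (W_[n])^*`, as the space of the linear functionals that vanish on all but
finitely many of the `W_[n]`. -/
def gradedDual (W : GradedSpace.{u}) : Submodule ℂ (Module.Dual ℂ W) where
  carrier := {φ | {n | ∃ w ∈ W.gr n, φ w ≠ 0}.Finite}
  add_mem' {φ ψ} hφ hψ := by
    refine (Set.Finite.union hφ hψ).subset ?_
    rintro n ⟨w, hw, h⟩
    by_cases h1 : φ w = 0
    · exact Or.inr ⟨w, hw, fun h2 => h (by simp [h1, h2])⟩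
    · exact Or.inl ⟨w, hw, h1⟩
  zero_mem' := by simp
  smul_mem' c φ hφ := by
    refine Set.Finite.subset hφ ?_
    rintro n ⟨w, hw, h⟩
    exact ⟨w, hw, fun h2 => h (by simp [h2])⟩

/-- The pairing `⟨w', x⟩` of the graded dual with the completion (a finite sum). -/
def pairing (W : GradedSpace.{u}) (φ : W.gradedDual) (x : W.Completion) : ℂ :=
  ∑ᶠ n, φ.1 (x n : W)

end GradedSpace

/-! ### Vertex operator algebras -/

/-- A vertex operator algebra over `ℂ`. The `n`-th mode of `Y(v, x) = ∑ v_n x^{-n-1}` is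
`(Y v).ncoeff n`; the Jacobi identity is written in terms of modes. -/
class VertexOperatorAlgebra (V : Type v) [AddCommGroup V] [Module ℂ V] where
  Y : V →ₗ[ℂ] VertexOperator ℂ V
  vac : V
  conf : V
  centralCharge : ℂ
  gr : ℤ → Submodule ℂ V
  internal : DirectSum.IsInternal gr
  finite_dim : ∀ n, FiniteDimensional ℂ (gr n)
  lower_bounded : ∃ N : ℤ, ∀ n < N, gr n = ⊥
  vac_mem : vac ∈ gr 0
  conf_mem : conf ∈ gr 2
  vac_mode : ∀ (n : ℤ) (v : V), (Y vac).ncoeff n v = if n = -1 then v else 0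
  creation : ∀ v : V, (Y v).ncoeff (-1) vac = v ∧ ∀ n : ℤ, 0 ≤ n → (Y v).ncoeff n vac = 0
  jacobi : ∀ (a b w : V) (l m n : ℤ),
    ∑ᶠ i : ℕ, Ring.choose m i • (Y ((Y a).ncoeff (l + i) b)).ncoeff (m + n - i) w =
      ∑ᶠ i : ℕ, ((-1 : ℤ) ^ i * Ring.choose l i) •
        ((Y a).ncoeff (m + l - i) ((Y b).ncoeff (n + i) w) -
          (l.negOnePow : ℤ) • (Y b).ncoeff (n + l - i) ((Y a).ncoeff (m + i) w))
  virasoro : ∀ (m n : ℤ) (v : V),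
    (Y conf).ncoeff (m + 1) ((Y conf).ncoeff (n + 1) v) -
        (Y conf).ncoeff (n + 1) ((Y conf).ncoeff (m + 1) v) =
      (m - n) • (Y conf).ncoeff (m + n + 1) v +
        (if m + n = 0 then ((m : ℂ) ^ 3 - m) / 12 * centralCharge else 0) • v
  L_zero : ∀ (n : ℤ), ∀ v ∈ gr n, (Y conf).ncoeff 1 v = n • v
  L_neg_one : ∀ (n : ℤ) (v w : V),
    (Y ((Y conf).ncoeff 0 v)).ncoeff n w = (-n) • (Y v).ncoeff (n - 1) w

namespace VertexOperatorAlgebra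

variable (V : Type v) [AddCommGroup V] [Module ℂ V] [VertexOperatorAlgebra V]

/-- The Virasoro operators `L(n) = ω_{n+1}` on `V`. -/
def L (n : ℤ) : V →ₗ[ℂ] V := (Y (conf (V := V))).ncoeff (n + 1)

/-- The projection of `V` onto its subspace of weight `n`. -/
def proj (n : ℤ) : V →ₗ[ℂ] V := gradedProj (gr (V := V)) internal n

/-- The automorphisms of the vertex operator algebra `V`, as a subgroup of the linear group. -/
def autSubgroup : Subgroup (V ≃ₗ[ℂ] V) where
  carrier := {g | g vac = vac ∧ g conf = conf ∧
    ∀ (a b : V) (n : ℤ), g ((Y a).ncoeff n b) = (Y (g a)).ncoeff n (g b)}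
  mul_mem' {g h} hg hh := by
    refine ⟨?_, ?_, fun a b n => ?_⟩
    · rw [LinearEquiv.mul_apply, hh.1, hg.1]
    · rw [LinearEquiv.mul_apply, hh.2.1, hg.2.1]
    · rw [LinearEquiv.mul_apply, hh.2.2, hg.2.2]; rfl
  one_mem' := ⟨rfl, rfl, fun _ _ _ => rfl⟩
  inv_mem' {g} hg := by
    refine ⟨?_, ?_, fun a b n => ?_⟩
    · exact g.symm_apply_eq.2 hg.1.symm
    · exact g.symm_apply_eq.2 hg.2.1.symm
    · refine g.symm_apply_eq.2 ?_
      rw [hg.2.2]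
      exact congrArg₂ (fun x y => (Y x).ncoeff n y) (g.apply_symm_apply a).symm
        (g.apply_symm_apply b).symm

/-- The automorphism group of the vertex operator algebra `V`. -/
abbrev Aut : Type v := autSubgroup V

end VertexOperatorAlgebra

open VertexOperatorAlgebra

/-! ### Twisted modules -/

/-- A bilinear map `A × B → W{x}[log x]`: `Y n k a b` is the coefficient of `x^{-n-1} (log x)^k`.
The second condition says that the value of the series at `x = z` makes sense as an element of the
algebraic completion `∏ W_[m]`. -/
structure IsLogSeries {A B : Type*} [AddCommGroup A] [Module ℂ A] [AddCommGroup B] [Module ℂ B]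
    (W : GradedSpace.{u}) (Y : ℂ → ℕ → A →ₗ[ℂ] B →ₗ[ℂ] W) : Prop where
  log_bounded : ∀ a b, ∃ K : ℕ, ∀ n k, K < k → Y n k a b = 0
  weight_finite : ∀ a b m, {n | ∃ k, W.proj m (Y n k a b) ≠ 0}.Finite

/-- The weight `m` component of the value `Y^p(a, z) b` of the `p`-th branch. -/
def evalBranch {A B : Type*} [AddCommGroup A] [Module ℂ A] [AddCommGroup B] [Module ℂ B]
    (W : GradedSpace.{u}) (Y : ℂ → ℕ → A →ₗ[ℂ] B →ₗ[ℂ] W) (p : ℤ) (z : ℂ) (a : A) (b : B)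
    (m : ℂ) : W :=
  ∑ᶠ q : ℂ × ℕ, monomialAt p q.1 q.2 z • W.proj m (Y q.1 q.2 a b)

/-- The branch `f^{p,p}` of
`∑ a_{ijkl} z₁^{m_i} z₂^{n_j} (log z₁)^k (log z₂)^l (z₁ - z₂)^{-t}`. -/
def correlationBranch (N t : ℕ) (m n : ℕ → ℂ) (a : ℕ → ℕ → ℕ → ℕ → ℂ) (p : ℤ) (z₁ z₂ : ℂ) : ℂ :=
  (∑ i ∈ Finset.range (N + 1), ∑ j ∈ Finset.range (N + 1), ∑ k ∈ Finset.range (N + 1),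
    ∑ l ∈ Finset.range (N + 1), a i j k l * Complex.exp (m i * logBranch p z₁) *
      Complex.exp (n j * logBranch p z₂) * logBranch p z₁ ^ k * logBranch p z₂ ^ l) *
    ((z₁ - z₂) ^ t)⁻¹

/-- A lower-bounded generalized `g`-twisted `V`-module without a `g`-action, bundled with `g`. -/
structure TwistedModule (V : Type v) [AddCommGroup V] [Module ℂ V] [VertexOperatorAlgebra V]
    extends GradedSpace.{u} where
  g : Aut V
  Y : ℂ → ℕ → V →ₗ[ℂ] carrier →ₗ[ℂ] carrier
  log_series : IsLogSeries toGradedSpace Y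
  equivariance : ∀ (p : ℤ) (z : ℂ), z ≠ 0 → ∀ (v : V) (w : carrier) (m : ℂ),
    evalBranch toGradedSpace Y (p + 1) z (g.1 v) w m = evalBranch toGradedSpace Y p z v w m
  identity : ∀ (n : ℂ) (k : ℕ) (w : carrier), Y n k vac w = if n = -1 ∧ k = 0 then w else 0
  duality : ∀ (a b : V) (w : carrier), ∀ φ ∈ toGradedSpace.gradedDual,
    ∃ (N t : ℕ) (r s : ℕ → ℂ) (c : ℕ → ℕ → ℕ → ℕ → ℂ), ∀ (p : ℤ) (z₁ z₂ : ℂ),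
      (‖z₂‖ < ‖z₁‖ → 0 < ‖z₂‖ →
        HasSum (fun q : ℂ × (ℂ × ℕ) × (ℂ × ℕ) =>
          φ (Y q.2.1.1 q.2.1.2 a (toGradedSpace.proj q.1 (Y q.2.2.1 q.2.2.2 b w))) *
            monomialAt p q.2.1.1 q.2.1.2 z₁ * monomialAt p q.2.2.1 q.2.2.2 z₂)
          (correlationBranch N t r s c p z₁ z₂)) ∧
      (‖z₁‖ < ‖z₂‖ → 0 < ‖z₁‖ →
        HasSum (fun q : ℂ × (ℂ × ℕ) × (ℂ × ℕ) =>
          φ (Y q.2.1.1 q.2.1.2 b (toGradedSpace.proj q.1 (Y q.2.2.1 q.2.2.2 a w))) *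
            monomialAt p q.2.1.1 q.2.1.2 z₂ * monomialAt p q.2.2.1 q.2.2.2 z₁)
          (correlationBranch N t r s c p z₁ z₂)) ∧
      (‖z₁ - z₂‖ < ‖z₂‖ → 0 < ‖z₁ - z₂‖ →
        ∃ S : ℂ, HasSum (fun q : ℤ × ℤ × (ℂ × ℕ) =>
          φ (Y q.2.2.1 q.2.2.2
              (VertexOperatorAlgebra.proj V q.1 ((VertexOperatorAlgebra.Y a).ncoeff q.2.1 b)) w) *
            (z₁ - z₂) ^ (-q.2.1 - 1) * monomialAt p q.2.2.1 q.2.2.2 z₂) S ∧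
          (|argPos z₁ - argPos z₂| < Real.pi / 2 → S = correlationBranch N t r s c p z₁ z₂))
  L_zero_grading : ∀ n, ∀ w ∈ gr n, ∃ K : ℕ,
    ((Y 1 0 (conf (V := V)) - n • LinearMap.id : Module.End ℂ carrier) ^ K) w = 0
  L_neg_one : ∀ (n : ℂ) (k : ℕ) (v : V) (w : carrier), Y n k (L V (-1) v) w =
    (-n) • Y (n - 1) k v w + ((k : ℂ) + 1) • Y (n - 1) (k + 1) v w
  lower_bounded : ∀ n : ℂ, ∃ R : ℝ, ∀ l : ℝ, l < R → gr (n + (l : ℂ)) = ⊥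

section Twisted

variable {V : Type v} [AddCommGroup V] [Module ℂ V] [VertexOperatorAlgebra V]

instance : CoeSort (TwistedModule.{u} V) (Type u) := ⟨fun M => M.carrier⟩

/-- A module map: a linear map between modules twisted by the same automorphism that commutes with
the twisted vertex operators. -/
@[ext]
structure ModuleMap (M N : TwistedModule.{u} V) where
  g_eq : M.g = N.g
  toLinearMap : M →ₗ[ℂ] N
  map_Y : ∀ n k v w, toLinearMap (M.Y n k v w) = N.Y n k v (toLinearMap w)

instance : CategoryTheory.Category (TwistedModule.{u} V) where
  Hom M N := ModuleMap M N
  id M := ⟨rfl, LinearMap.id, fun _ _ _ _ => rfl⟩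
  comp f h := ⟨f.g_eq.trans h.g_eq, h.toLinearMap ∘ₗ f.toLinearMap, fun n k v w => by
    simp [f.map_Y, h.map_Y]⟩

/-- `M'` is the contragredient of `M`: it is the graded dual of `M` with the twisted vertex operator
map given by `⟨Y'(v, x) w', w⟩ = ⟨w', Y(e^{x L(1)} (-x^{-2})^{L(0)} v, x^{-1}) w⟩`. For `v` of weight
`h`, the right-hand side is written through its coefficient of `x^{-n-1} (log x)^k`. -/
structure Contragredient (M M' : TwistedModule.{u} V) where
  g_eq : M'.g = M.g⁻¹
  equiv : M' ≃ₗ[ℂ] M.gradedDual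
  mem_gr : ∀ n w', w' ∈ M'.gr n ↔ ∀ m, m ≠ n → ∀ w ∈ M.gr m, (equiv w').1 w = 0
  formula : ∀ (h : ℤ), ∀ v ∈ VertexOperatorAlgebra.gr (V := V) h, ∀ (n : ℂ) (k : ℕ) (w' : M') (w : M),
    (equiv (M'.Y n k v w')).1 w =
      ∑ᶠ i : ℕ, ((-1 : ℂ) ^ h * (-1) ^ k / (Nat.factorial i : ℂ)) *
        (equiv w').1 (M.Y (2 * (h : ℂ) - n - 2 - i) k (((L V 1) ^ i : Module.End ℂ V) v) w)

/-! ### Twisted intertwining operators -/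

/-- `𝒴` is a twisted intertwining operator of type `(M₃; M₁ M₂)`; `𝒴 n k w₁ w₂` is the coefficient of
`x^{-n-1} (log x)^k` in `𝒴(w₁, x) w₂`. -/
structure IsTwistedIntertwining (M₁ M₂ M₃ : TwistedModule.{u} V)
    (𝒴 : ℂ → ℕ → M₁ →ₗ[ℂ] M₂ →ₗ[ℂ] M₃) : Prop where
  log_series : IsLogSeries M₃.toGradedSpace 𝒴
  lower_truncation : ∀ w₁ w₂ n k, ∃ l₀ : ℕ, ∀ l : ℕ, l₀ ≤ l → 𝒴 (n + l) k w₁ w₂ = 0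
  duality : ∀ (a : V) (w₁ : M₁) (w₂ : M₂), ∀ φ ∈ M₃.gradedDual,
    ∃ f : (Fin 2 → ℂ) → ℂ, IsPreferredBranch f ∧ ∀ z₁ z₂ : ℂ,
      (‖z₂‖ < ‖z₁‖ → 0 < ‖z₂‖ →
        ∃ S : ℂ, HasSum (fun q : ℂ × (ℂ × ℕ) × (ℂ × ℕ) =>
          φ (M₃.Y q.2.1.1 q.2.1.2 a (M₃.proj q.1 (𝒴 q.2.2.1 q.2.2.2 w₁ w₂))) *
            monomialAt 0 q.2.1.1 q.2.1.2 z₁ * monomialAt 0 q.2.2.1 q.2.2.2 z₂) S ∧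
          (|argPos (z₁ - z₂) - argPos z₁| < Real.pi / 2 → S = f ![z₁, z₂])) ∧
      (‖z₁‖ < ‖z₂‖ → 0 < ‖z₁‖ →
        ∃ S : ℂ, HasSum (fun q : ℂ × (ℂ × ℕ) × (ℂ × ℕ) =>
          φ (𝒴 q.2.1.1 q.2.1.2 w₁ (M₂.proj q.1 (M₂.Y q.2.2.1 q.2.2.2 a w₂))) *
            monomialAt 0 q.2.1.1 q.2.1.2 z₂ * monomialAt 0 q.2.2.1 q.2.2.2 z₁) S ∧
          (-(3 * Real.pi / 2) < argPos (z₁ - z₂) - argPos z₂ →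
            argPos (z₁ - z₂) - argPos z₂ < -(Real.pi / 2) → S = f ![z₁, z₂])) ∧
      (‖z₁ - z₂‖ < ‖z₂‖ → 0 < ‖z₁ - z₂‖ →
        ∃ S : ℂ, HasSum (fun q : ℂ × (ℂ × ℕ) × (ℂ × ℕ) =>
          φ (𝒴 q.2.2.1 q.2.2.2 (M₁.proj q.1 (M₁.Y q.2.1.1 q.2.1.2 a w₁)) w₂) *
            monomialAt 0 q.2.1.1 q.2.1.2 (z₁ - z₂) * monomialAt 0 q.2.2.1 q.2.2.2 z₂) S ∧
          (|argPos z₁ - argPos z₂| < Real.pi / 2 → S = f ![z₁, z₂]))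
  /- Products of `d ≥ 2` twisted vertex operators with `𝒴`: the `i`-th vertex operator contributes its
  coefficient of index `(q.1 i).2`, applied after the projection to the weight `(q.1 i).1`. -/
  convergence : ∀ (d : ℕ), 2 ≤ d → ∀ (a : Fin d → V) (w₁ : M₁) (w₂ : M₂), ∀ φ ∈ M₃.gradedDual,
    ∃ S : (Fin (d + 1) → ℂ) → ℂ,
      (∀ z : Fin (d + 1) → ℂ, StrictAnti (fun i => ‖z i‖) → 0 < ‖z (Fin.last d)‖ →
        HasSum (fun q : (Fin d → ℂ × ℂ × ℕ) × (ℂ × ℕ) =>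
          φ ((List.ofFn fun i => (a i, q.1 i)).foldr
              (fun s x => M₃.Y s.2.2.1 s.2.2.2 s.1 (M₃.proj s.2.1 x)) (𝒴 q.2.1 q.2.2 w₁ w₂)) *
            (∏ i, monomialAt 0 (q.1 i).2.1 (q.1 i).2.2 (z i.castSucc)) *
            monomialAt 0 q.2.1 q.2.2 (z (Fin.last d))) (S z)) ∧
      ∀ z : Fin (d + 1) → ℂ, StrictAnti (fun i => ‖z i‖) → 0 < ‖z (Fin.last d)‖ →
        (∀ i, argPos (z i) ≠ 0) →
        ExtendsToMultivalued (configSpace (d + 1)) z S ∧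
        ∀ A β δ, IsComponentIsolated (configSpace (d + 1)) A β δ →
          IsRegularSingularity (configSpace (d + 1)) z S A β δ
  L_neg_one : ∀ (n : ℂ) (k : ℕ) (w₁ : M₁) (w₂ : M₂), 𝒴 n k (M₁.Y 0 0 conf w₁) w₂ =
    (-n) • 𝒴 (n - 1) k w₁ w₂ + ((k : ℂ) + 1) • 𝒴 (n - 1) (k + 1) w₁ w₂

/-- `I` is a twisted `P(z)`-intertwining map of type `(M₃; M₁ M₂)`, that is
`I(w₁ ⊗ w₂) = 𝒴(w₁, z) w₂` for a twisted intertwining operator `𝒴`, where `M₃` is twisted by the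
product of the automorphisms of `M₁` and `M₂`. -/
def IsPzIntertwiningMap (z : ℂ) (M₁ M₂ M₃ : TwistedModule.{u} V)
    (I : M₁ ⊗[ℂ] M₂ →ₗ[ℂ] M₃.Completion) : Prop :=
  M₃.g = M₁.g * M₂.g ∧ ∃ 𝒴, IsTwistedIntertwining M₁ M₂ M₃ 𝒴 ∧
    ∀ w₁ w₂ m, (I (w₁ ⊗ₜ w₂) m : M₃) = evalBranch M₃.toGradedSpace 𝒴 0 z w₁ w₂ m

/-! ### The categories of twisted modules -/

/-- A lower-bounded generalized `g`-twisted `V`-module with a `g`-action, `g ∈ G`, together with an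
extension of the `g`-action to a linear action of `G`. -/
structure TwistedModuleWithAction (G : Subgroup (Aut V)) extends TwistedModule.{u} V where
  g_mem : g ∈ G
  act : Representation ℂ G carrier
  bigr : ℂ → (ℂ ⧸ AddSubgroup.zmultiples (1 : ℂ)) → Submodule ℂ carrier
  bigr_internal : by
    classical exact DirectSum.IsInternal (fun q : ℂ × (ℂ ⧸ AddSubgroup.zmultiples (1 : ℂ)) =>
      bigr q.1 q.2)
  gr_eq : ∀ n, gr n = ⨆ α, bigr n α
  g_grading : ∃ Λ : ℕ, 0 < Λ ∧ ∀ (α : ℂ), ∀ w ∈ ⨆ n, bigr n (QuotientAddGroup.mk α),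
    ((act ⟨g, g_mem⟩ - Complex.exp (2 * Real.pi * α * Complex.I) • LinearMap.id :
      Module.End ℂ carrier) ^ Λ) w = 0
  g_compat : ∀ n k v w, act ⟨g, g_mem⟩ (Y n k v w) = Y n k (g.1 v) (act ⟨g, g_mem⟩ w)

/-- A category of `g`-twisted `V`-modules for `g ∈ G`, given by its class of objects: either of modules
without actions, or of modules with actions of `G`. -/
inductive TwistedCategory (G : Subgroup (Aut V)) : Type (max v (u + 1))
  | withoutActions (P : TwistedModule.{u} V → Prop) (hP : ∀ M, P M → M.g ∈ G)
  | withActions (P : TwistedModuleWithAction.{u} G → Prop)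

namespace TwistedCategory

variable {G : Subgroup (Aut V)}

/-- The objects of the category. -/
def Obj : TwistedCategory.{u} G → Type (max v (u + 1))
  | withoutActions P _ => {M // P M}
  | withActions P => {M // P M}

/-- The underlying twisted module of an object. -/
def mod : (C : TwistedCategory.{u} G) → C.Obj → TwistedModule.{u} V
  | withoutActions _ _ => fun M => M.1
  | withActions _ => fun M => M.1.toTwistedModule

variable (C : TwistedCategory.{u} G)

/-- The morphisms between two objects are all the module maps. -/
instance : CategoryTheory.Category C.Obj where
  Hom W W' := ModuleMap (C.mod W) (C.mod W')
  id W := CategoryTheory.CategoryStruct.id (C.mod W)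
  comp f h := CategoryTheory.CategoryStruct.comp (obj := TwistedModule.{u} V) f h

/-- The subspace `W₁ ⧅ W₂` of `(W₁ ⊗ W₂)^*` spanned by the functionals
`λ_{I, w'} = ⟨w', I(·)⟩` for all `P(z)`-products `(W₃, I)` of `W₁` and `W₂` in the category
and all `w' ∈ W₃'`. -/
def hboxtr (z : ℂ) (W₁ W₂ : C.Obj) : Submodule ℂ (Module.Dual ℂ (C.mod W₁ ⊗[ℂ] C.mod W₂)) :=
  Submodule.span ℂ {l | ∃ (W₃ : C.Obj) (I : C.mod W₁ ⊗[ℂ] C.mod W₂ →ₗ[ℂ] (C.mod W₃).Completion),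
    IsPzIntertwiningMap z (C.mod W₁) (C.mod W₂) (C.mod W₃) I ∧
      ∃ φ : (C.mod W₃).gradedDual, ∀ t, l t = (C.mod W₃).pairing φ (I t)}

/-- `H` is the space `W₁ ⧅ W₂` with its `(g₁ g₂)⁻¹`-twisted module structure, for which
`w' ↦ λ_{I, w'}` preserves gradings and `Y(v, x) λ_{I, w'} = λ_{I, Y'(v, x) w'}`, for each
`P(z)`-product `(W₃, I)`, with `Y'` the twisted vertex operator map of the contragredient of `W₃`. -/
structure HboxtrModule (z : ℂ) (W₁ W₂ : C.Obj) (H : TwistedModule.{u} V) where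
  g_eq : H.g = ((C.mod W₁).g * (C.mod W₂).g)⁻¹
  equiv : H ≃ₗ[ℂ] C.hboxtr z W₁ W₂
  compat : ∀ (W₃ : C.Obj) (I : C.mod W₁ ⊗[ℂ] C.mod W₂ →ₗ[ℂ] (C.mod W₃).Completion),
    IsPzIntertwiningMap z (C.mod W₁) (C.mod W₂) (C.mod W₃) I →
    ∀ (M' : TwistedModule.{u} V) (c : Contragredient (C.mod W₃) M') (w' : M') (x : H),
      (∀ t, (equiv x).1 t = (C.mod W₃).pairing (c.equiv w') (I t)) →
      (∀ m, w' ∈ M'.gr m → x ∈ H.gr m) ∧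
      ∀ n k v t, (equiv (H.Y n k v x)).1 t =
        (C.mod W₃).pairing (c.equiv (M'.Y n k v w')) (I t)

/-- The assumption on the category: it contains `W₁ ⧅ W₂` for all its objects `W₁` and `W₂`, it
contains the contragredients of its objects, and the double contragredient of an object is
equivalent to the object. -/
structure TensorAssumption (z : ℂ) : Prop where
  hboxtr_mem : ∀ W₁ W₂ : C.Obj, ∃ H : C.Obj, Nonempty (C.HboxtrModule z W₁ W₂ (C.mod H))
  contragredient_mem : ∀ W : C.Obj, ∃ W' : C.Obj, Nonempty (Contragredient (C.mod W) (C.mod W'))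
  double_contragredient : ∀ (W : C.Obj) (M' M'' : TwistedModule.{u} V),
    Contragredient (C.mod W) M' → Contragredient M' M'' →
      ∃ f : ModuleMap M'' (C.mod W), Function.Bijective f.toLinearMap

/-- The object `W₁ ⊠ W₂ = (W₁ ⧅ W₂)'` of the category. -/
structure TensorObj (z : ℂ) (W₁ W₂ : C.Obj) where
  hbox : C.Obj
  hbox_str : C.HboxtrModule z W₁ W₂ (C.mod hbox)
  obj : C.Obj
  contra : Contragredient (C.mod hbox) (C.mod obj)

variable {C}

theorem gradedProj_of_ne {ι W : Type*} [DecidableEq ι] [AddCommGroup W] [Module ℂ W]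
    (gr : ι → Submodule ℂ W) (h : DirectSum.IsInternal gr) {m n : ι} (hmn : m ≠ n) {w : W}
    (hw : w ∈ gr m) : gradedProj gr h n w = 0 := by
  have : (LinearEquiv.ofBijective (DirectSum.coeLinearMap gr) (coeLinearMap_bijective h)).symm w =
      DirectSum.lof ℂ ι (fun i => gr i) m ⟨w, hw⟩ := by
    rw [LinearEquiv.symm_apply_eq]
    simp
  simp only [gradedProj, LinearMap.comp_apply, LinearEquiv.coe_coe, this]
  rw [DirectSum.component.of, dif_neg hmn]
  simp

/-- For `t ∈ W₁ ⊗ W₂` the functional `λ ↦ (π_n λ)(t)` on `W₁ ⧅ W₂`. -/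
def TensorObj.evalAt {z : ℂ} {W₁ W₂ : C.Obj} (T : C.TensorObj z W₁ W₂) (n : ℂ) :
    C.mod W₁ ⊗[ℂ] C.mod W₂ →ₗ[ℂ] Module.Dual ℂ (C.mod T.hbox) :=
  LinearMap.flip ((C.hboxtr z W₁ W₂).subtype ∘ₗ T.hbox_str.equiv.toLinearMap ∘ₗ
    (C.mod T.hbox).proj n)

theorem TensorObj.evalAt_eq_zero {z : ℂ} {W₁ W₂ : C.Obj} (T : C.TensorObj z W₁ W₂) (n : ℂ)
    (t : C.mod W₁ ⊗[ℂ] C.mod W₂) (m : ℂ) (hmn : m ≠ n) (w : C.mod T.hbox)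
    (hw : w ∈ (C.mod T.hbox).gr m) : T.evalAt n t w = 0 := by
  have : (C.mod T.hbox).proj n w = 0 := gradedProj_of_ne _ _ hmn hw
  simp [TensorObj.evalAt, this]

theorem TensorObj.evalAt_mem {z : ℂ} {W₁ W₂ : C.Obj} (T : C.TensorObj z W₁ W₂) (n : ℂ)
    (t : C.mod W₁ ⊗[ℂ] C.mod W₂) : T.evalAt n t ∈ (C.mod T.hbox).gradedDual := by
  refine (Set.finite_singleton n).subset ?_
  rintro m ⟨w, hw, h⟩
  by_contra hmn
  exact h (T.evalAt_eq_zero n t m hmn w hw)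

/-- The map `⊠ : W₁ ⊗ W₂ → ∏ (W₁ ⊠ W₂)_[n]` determined by `⟨λ, w₁ ⊠ w₂⟩ = λ(w₁ ⊗ w₂)` for
`λ ∈ W₁ ⧅ W₂`. -/
def TensorObj.boxtimes {z : ℂ} {W₁ W₂ : C.Obj} (T : C.TensorObj z W₁ W₂) :
    C.mod W₁ ⊗[ℂ] C.mod W₂ →ₗ[ℂ] (C.mod T.obj).Completion :=
  LinearMap.pi fun n => LinearMap.codRestrict _
    (T.contra.equiv.symm.toLinearMap ∘ₗ LinearMap.codRestrict _ (T.evalAt n) (T.evalAt_mem n))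
    fun t => (T.contra.mem_gr n _).2 fun m hmn w hw => by
      simpa using T.evalAt_eq_zero n t m hmn w hw

/-- `f` is a map `W₁ ⊠ W₂ → W₃` with `f̄ ∘ ⊠ = I`, where `f̄` is the natural extension of `f` to the
completions. -/
def TensorObj.Factors {z : ℂ} {W₁ W₂ : C.Obj} (T : C.TensorObj z W₁ W₂) {W₃ : C.Obj}
    (I : C.mod W₁ ⊗[ℂ] C.mod W₂ →ₗ[ℂ] (C.mod W₃).Completion) (f : T.obj ⟶ W₃) : Prop :=
  ∀ t n, f.toLinearMap (T.boxtimes t n : C.mod T.obj) = I t n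

/-- The map `⊠ ∘ (f₁ ⊗ f₂)`. -/
def TensorObj.boxtimesComp {z : ℂ} {W₁ W₁' W₂ W₂' : C.Obj} (T' : C.TensorObj z W₁' W₂')
    (f₁ : W₁ ⟶ W₁') (f₂ : W₂ ⟶ W₂') :
    C.mod W₁ ⊗[ℂ] C.mod W₂ →ₗ[ℂ] (C.mod T'.obj).Completion :=
  T'.boxtimes ∘ₗ TensorProduct.map f₁.toLinearMap f₂.toLinearMap

end TwistedCategory

end Twisted

end

/-!
The tensor product is dual to `W₁ ⧅ W₂`, so every module map out of `W₁ ⊠ W₂ = (W₁ ⧅ W₂)'` is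
obtained as the transpose of a module map into `W₁ ⧅ W₂`.

A module map commutes with `L(0)`, whose generalized eigenspaces are the weight spaces, hence it
preserves weights (`ModuleMap.map_gr`) and has a transpose between contragredients
(`ModuleMap.transpose`). Since `e^{xL(1)} (-x^{-2})^{L(0)}` and its counterpart at `x⁻¹` are inverse
to each other, the canonical map `W → W''` is a module map (`Contragredient.toDouble`). The
assumption provides only some isomorphism `W'' ≅ W`, but this already forces each weight space to
be isomorphic to its double dual, hence to be finite-dimensional, and so the canonical map is
bijective (`TwistedCategory.TensorAssumption.toDouble_bijective`).

For a `P(z)`-product `(W₃, I)` the map `w' ↦ λ_{I, w'}` is a module map `W₃' → W₁ ⧅ W₂`. Its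
transpose `W₁ ⊠ W₂ → W₃''`, followed by the inverse of `W₃ → W₃''`, is the map required by the
universal property (`TwistedCategory.TensorObj.exists_factors`). It is unique because a functional
on `W₁ ⊠ W₂` in the graded dual is, by bijectivity of the canonical map for `W₁ ⧅ W₂`, the
evaluation at an element of `W₁ ⧅ W₂`, and this element is determined by its values on
`W₁ ⊗ W₂` (`TwistedCategory.TensorObj.hom_ext`).

For morphisms `f₁`, `f₂`, composing a twisted intertwining operator with `f₁ ⊗ f₂` gives a twisted
intertwining operator. Hence `λ ↦ λ ∘ (f₁ ⊗ f₂)` is a module map `W₁' ⧅ W₂' → W₁ ⧅ W₂`, and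
`f₁ ⊠ f₂` is its transpose (`TwistedCategory.TensorObj.map`). In particular it is not needed that `⊠`
is itself a `P(z)`-intertwining map. Functoriality follows from uniqueness.
-/

noncomputable section

/-! ### Graded spaces -/

/-- A grading by generalized eigenspaces of `T` consists of the full generalized eigenspaces. -/
theorem maxGenEigenspace_eq_of_isInternal {ι W : Type*} [DecidableEq ι] [AddCommGroup W]
    [Module ℂ W] {gr : ι → Submodule ℂ W} (hgr : DirectSum.IsInternal gr) (T : Module.End ℂ W)
    {e : ι → ℂ} (he : Function.Injective e) (h : ∀ i, gr i ≤ T.maxGenEigenspace (e i)) (i : ι) :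
    T.maxGenEigenspace (e i) = gr i := by
  refine le_antisymm (fun v hv => ?_) (h i)
  have hind : iSupIndep fun i => T.maxGenEigenspace (e i) :=
    (Module.End.independent_maxGenEigenspace T).comp he
  have htop : v ∈ gr i ⊔ ⨆ j, ⨆ _ : j ≠ i, gr j := by
    have hle : ⨆ j, gr j ≤ gr i ⊔ ⨆ j, ⨆ _ : j ≠ i, gr j := iSup_le fun j => by
      by_cases hj : j = i
      · exact hj ▸ le_sup_left
      · exact le_sup_of_le_right (le_iSup₂_of_le j hj le_rfl)
    exact hle (by rw [hgr.submodule_iSup_eq_top]; trivial)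
  obtain ⟨a, ha, b, hb, rfl⟩ := Submodule.mem_sup.1 htop
  have hb' : b ∈ ⨆ j, ⨆ _ : j ≠ i, T.maxGenEigenspace (e j) :=
    iSup₂_mono (fun j _ => h j) hb
  have hbi : b ∈ T.maxGenEigenspace (e i) := by
    simpa using sub_mem hv (h i ha)
  have : b = 0 := (Submodule.disjoint_def.1 (hind i)) b hbi hb'
  simpa [this] using ha

theorem gradedProj_mem {ι W : Type*} [DecidableEq ι] [AddCommGroup W] [Module ℂ W]
    (gr : ι → Submodule ℂ W) (h : DirectSum.IsInternal gr) (n : ι) (w : W) :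
    gradedProj gr h n w ∈ gr n := by
  simp [gradedProj]

theorem gradedProj_of_mem {ι W : Type*} [DecidableEq ι] [AddCommGroup W] [Module ℂ W]
    (gr : ι → Submodule ℂ W) (h : DirectSum.IsInternal gr) {n : ι} {w : W}
    (hw : w ∈ gr n) : gradedProj gr h n w = w := by
  have : (LinearEquiv.ofBijective (DirectSum.coeLinearMap gr) (coeLinearMap_bijective h)).symm w =
      DirectSum.lof ℂ ι (fun i => gr i) n ⟨w, hw⟩ := by
    rw [LinearEquiv.symm_apply_eq]
    simp
  simp only [gradedProj, LinearMap.comp_apply, LinearEquiv.coe_coe, this]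
  rw [DirectSum.component.lof_self]
  simp

namespace GradedSpace

variable (W : GradedSpace.{u})

theorem proj_mem (n : ℂ) (w : W) : W.proj n w ∈ W.gr n := gradedProj_mem _ _ _ _

theorem proj_of_mem {n : ℂ} {w : W} (hw : w ∈ W.gr n) : W.proj n w = w := gradedProj_of_mem _ _ hw

theorem proj_of_ne {m n : ℂ} (hmn : m ≠ n) {w : W} (hw : w ∈ W.gr m) : W.proj n w = 0 :=
  TwistedCategory.gradedProj_of_ne _ _ hmn hw

theorem induction_on {p : W → Prop} (w : W) (hgr : ∀ n, ∀ w ∈ W.gr n, p w) (h0 : p 0)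
    (hadd : ∀ w₁ w₂, p w₁ → p w₂ → p (w₁ + w₂)) : p w :=
  Submodule.iSup_induction W.gr (motive := p)
    (by rw [W.internal.submodule_iSup_eq_top]; trivial) hgr h0 hadd

theorem finite_proj_ne_zero (w : W) : {n | W.proj n w ≠ 0}.Finite := by
  induction w using W.induction_on with
  | hgr m w hw =>
    refine (Set.finite_singleton m).subset fun n hn => ?_
    by_contra h
    exact hn (W.proj_of_ne (Ne.symm h) hw)
  | h0 => simp
  | hadd w₁ w₂ h₁ h₂ =>
    refine (h₁.union h₂).subset fun n hn => ?_
    by_contra h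
    simp only [Set.mem_union, Set.mem_ofPred_eq, not_or, not_not] at h
    exact hn (by simp [h])

theorem eq_zero_of_proj_eq_zero {w : W} (h : ∀ n, W.proj n w = 0) : w = 0 := by
  -- The projections are the components of the inverse of `⨁ W_[n] → W`.
  refine (LinearEquiv.map_eq_zero_iff (LinearEquiv.ofBijective (DirectSum.coeLinearMap W.gr)
    (coeLinearMap_bijective W.internal)).symm).1 (DFinsupp.ext fun n => Subtype.ext ?_)
  exact h n

/-- A linear map that vanishes on all the weight spaces but one factors through the projection. -/
theorem apply_proj_of_vanish {A : Type*} [AddCommGroup A] [Module ℂ A] (φ : W →ₗ[ℂ] A) {n : ℂ}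
    (h : ∀ m, m ≠ n → ∀ w ∈ W.gr m, φ w = 0) (w : W) : φ (W.proj n w) = φ w := by
  induction w using W.induction_on with
  | hgr m w hw =>
    by_cases hmn : m = n
    · subst hmn; rw [W.proj_of_mem hw]
    · rw [W.proj_of_ne hmn hw, h m hmn w hw, map_zero]
  | h0 => simp
  | hadd w₁ w₂ h₁ h₂ => simp [h₁, h₂]

theorem comp_proj_mem_gradedDual (n : ℂ) (φ : Module.Dual ℂ W) :
    φ ∘ₗ W.proj n ∈ W.gradedDual := by
  refine (Set.finite_singleton n).subset ?_
  rintro m ⟨w, hw, h⟩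
  by_contra hmn
  exact h (by simp [W.proj_of_ne hmn hw])

/-- The graded dual separates points. -/
theorem eq_zero_of_gradedDual {w : W} (h : ∀ φ ∈ W.gradedDual, φ w = 0) : w = 0 :=
  W.eq_zero_of_proj_eq_zero fun n => (Module.forall_dual_apply_eq_zero_iff ℂ _).1 fun φ =>
    h _ (W.comp_proj_mem_gradedDual n φ)

theorem finite_support_pairing (φ : W.gradedDual) (x : W.Completion) :
    (Function.support fun n => φ.1 (x n : W)).Finite :=
  φ.2.subset fun n hn => ⟨x n, (x n).2, hn⟩

/-- The pairing of the graded dual with the completion as a bilinear map. -/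
def pairingₗ : W.gradedDual →ₗ[ℂ] W.Completion →ₗ[ℂ] ℂ :=
  LinearMap.mk₂ ℂ W.pairing
    (fun φ ψ x => by
      simp only [pairing, Submodule.coe_add, LinearMap.add_apply]
      exact finsum_add_distrib (W.finite_support_pairing φ x) (W.finite_support_pairing ψ x))
    (fun c φ x => by
      simp only [pairing, Submodule.coe_smul, LinearMap.smul_apply]
      exact (smul_finsum c _).symm)
    (fun φ x y => by
      simp only [pairing, Pi.add_apply, Submodule.coe_add, map_add]
      exact finsum_add_distrib (W.finite_support_pairing φ x) (W.finite_support_pairing φ y))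
    (fun c φ x => by
      simp only [pairing, Pi.smul_apply, Submodule.coe_smul, map_smul]
      exact (smul_finsum c _).symm)

@[simp]
theorem pairingₗ_apply (φ : W.gradedDual) (x : W.Completion) :
    W.pairingₗ φ x = W.pairing φ x := rfl

theorem pairing_of_vanish (φ : W.gradedDual) {n : ℂ}
    (h : ∀ m, m ≠ n → ∀ w ∈ W.gr m, φ.1 w = 0) (x : W.Completion) :
    W.pairing φ x = φ.1 (x n) :=
  finsum_eq_single _ _ fun m hm => h m hm _ (x m).2

end GradedSpace

/-! ### The action of `L(1)` on a vertex operator algebra -/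

namespace VertexOperatorAlgebra

variable {V : Type v} [AddCommGroup V] [Module ℂ V] [VertexOperatorAlgebra V]

theorem L_one_mem {h : ℤ} {v : V} (hv : v ∈ gr (V := V) h) : L V 1 v ∈ gr (V := V) (h - 1) := by
  have hE := maxGenEigenspace_eq_of_isInternal (internal (V := V))
    ((Y (conf (V := V))).ncoeff 1) (e := fun n : ℤ => (n : ℂ)) Int.cast_injective
    (fun n w hw => by
      rw [Module.End.mem_maxGenEigenspace]
      exact ⟨1, by simp [L_zero n w hw, Int.cast_smul_eq_zsmul]⟩) (h - 1)
  rw [← hE, Module.End.mem_maxGenEigenspace]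
  refine ⟨1, ?_⟩
  -- The relation `[L(0), L(1)] = -L(1)`.
  have key := virasoro 0 1 v
  simp only [zero_add, L_zero h v hv, map_zsmul] at key
  norm_num at key
  simp only [L, pow_one, LinearMap.sub_apply, LinearMap.smul_apply, Module.End.one_apply]
  rw [sub_eq_iff_eq_add] at key
  norm_num
  rw [key, sub_smul, one_smul, Int.cast_smul_eq_zsmul]
  abel

theorem L_one_pow_mem {h : ℤ} {v : V} (hv : v ∈ gr (V := V) h) (i : ℕ) :
    ((L V 1) ^ i : Module.End ℂ V) v ∈ gr (V := V) (h - i) := by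
  induction i with
  | zero => simpa using hv
  | succ i ih =>
    rw [pow_succ', Module.End.mul_apply]
    convert L_one_mem ih using 2
    push_cast; ring

theorem exists_L_one_pow_eq_zero {h : ℤ} {v : V} (hv : v ∈ gr (V := V) h) :
    ∃ N : ℕ, ∀ i, N ≤ i → ((L V 1) ^ i : Module.End ℂ V) v = 0 := by
  obtain ⟨N, hN⟩ := lower_bounded (V := V)
  refine ⟨(h - N + 1).toNat, fun i hi => ?_⟩
  have := L_one_pow_mem hv i
  rw [hN _ (by omega)] at this
  simpa using this

theorem induction_on {p : V → Prop} (v : V) (hgr : ∀ n, ∀ v ∈ gr (V := V) n, p v) (h0 : p 0)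
    (hadd : ∀ v₁ v₂, p v₁ → p v₂ → p (v₁ + v₂)) : p v :=
  Submodule.iSup_induction (gr (V := V)) (motive := p)
    (by rw [(internal (V := V)).submodule_iSup_eq_top]; trivial) hgr h0 hadd

end VertexOperatorAlgebra

open VertexOperatorAlgebra

variable {V : Type v} [AddCommGroup V] [Module ℂ V] [VertexOperatorAlgebra V]

/-! ### Module maps and contragredients -/

namespace TwistedModule

theorem maxGenEigenspace_L_zero (M : TwistedModule.{u} V) (n : ℂ) :
    Module.End.maxGenEigenspace (M.Y 1 0 (conf (V := V))) n = M.gr n :=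
  maxGenEigenspace_eq_of_isInternal M.internal _ (e := fun n => n) (fun _ _ h => h)
    (fun n w hw => (Module.End.mem_maxGenEigenspace _ _ _).2 (M.L_zero_grading n w hw)) n

end TwistedModule

namespace ModuleMap

variable {M N : TwistedModule.{u} V}

/-- Module maps preserve weights, since weight spaces are generalized eigenspaces of `L(0)`. -/
theorem map_gr (f : ModuleMap M N) {n : ℂ} {w : M} (hw : w ∈ M.gr n) :
    f.toLinearMap w ∈ N.gr n := by
  obtain ⟨K, hK⟩ := M.L_zero_grading n w hw
  rw [← N.maxGenEigenspace_L_zero, Module.End.mem_maxGenEigenspace]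
  refine ⟨K, ?_⟩
  have key : ∀ (j : ℕ) (x : M), f.toLinearMap
      (((M.Y 1 0 (conf (V := V)) - n • LinearMap.id : Module.End ℂ M) ^ j) x) =
      ((N.Y 1 0 (conf (V := V)) - n • 1 : Module.End ℂ N) ^ j) (f.toLinearMap x) := by
    intro j
    induction j with
    | zero => simp
    | succ j ih =>
      intro x
      rw [pow_succ, pow_succ, Module.End.mul_apply, Module.End.mul_apply, ih]
      simp [f.map_Y]
  rw [← key, hK, map_zero]

theorem map_proj (f : ModuleMap M N) (n : ℂ) (w : M) :
    f.toLinearMap (M.proj n w) = N.proj n (f.toLinearMap w) := by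
  induction w using M.induction_on with
  | hgr m w hw =>
    by_cases hmn : m = n
    · subst hmn; rw [M.proj_of_mem hw, N.proj_of_mem (f.map_gr hw)]
    · rw [M.proj_of_ne hmn hw, N.proj_of_ne hmn (f.map_gr hw), map_zero]
  | h0 => simp
  | hadd w₁ w₂ h₁ h₂ => simp [h₁, h₂]

theorem comp_mem_gradedDual (f : ModuleMap M N) {φ : Module.Dual ℂ N} (hφ : φ ∈ N.gradedDual) :
    φ ∘ₗ f.toLinearMap ∈ M.gradedDual := by
  refine Set.Finite.subset hφ ?_
  rintro n ⟨w, hw, h⟩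
  exact ⟨_, f.map_gr hw, h⟩

/-- The pullback of functionals along a module map. -/
def gradedDualMap (f : ModuleMap M N) : N.gradedDual →ₗ[ℂ] M.gradedDual :=
  LinearMap.codRestrict _ (f.toLinearMap.dualMap ∘ₗ N.gradedDual.subtype)
    fun φ => f.comp_mem_gradedDual φ.2

@[simp]
theorem gradedDualMap_apply (f : ModuleMap M N) (φ : N.gradedDual) (w : M) :
    (f.gradedDualMap φ).1 w = φ.1 (f.toLinearMap w) := rfl

/-- The inverse of a bijective module map. -/
def inverse (f : ModuleMap M N) (hf : Function.Bijective f.toLinearMap) : ModuleMap N M where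
  g_eq := f.g_eq.symm
  toLinearMap := (LinearEquiv.ofBijective f.toLinearMap hf).symm.toLinearMap
  map_Y n k v w := by
    obtain ⟨w, rfl⟩ := hf.2 w
    have h : ∀ x, (LinearEquiv.ofBijective f.toLinearMap hf).symm (f.toLinearMap x) = x :=
      (LinearEquiv.ofBijective f.toLinearMap hf).symm_apply_apply
    simp only [LinearEquiv.coe_coe, ← f.map_Y, h]

theorem inverse_apply (f : ModuleMap M N) (hf : Function.Bijective f.toLinearMap) (x : M) :
    (f.inverse hf).toLinearMap (f.toLinearMap x) = x :=
  (LinearEquiv.ofBijective f.toLinearMap hf).symm_apply_apply x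

end ModuleMap

namespace Contragredient

variable {M M' : TwistedModule.{u} V} (c : Contragredient M M')
include c

theorem apply_proj (n : ℂ) (w' : M') (w : M) :
    (c.equiv (M'.proj n w')).1 w = (c.equiv w').1 (M.proj n w) := by
  induction w' using M'.induction_on with
  | hgr m w' hw' =>
    have hv := (c.mem_gr m w').1 hw'
    by_cases hmn : m = n
    · subst hmn
      rw [M'.proj_of_mem hw']
      exact (M.apply_proj_of_vanish _ hv w).symm
    · rw [M'.proj_of_ne hmn hw', hv n (Ne.symm hmn) _ (M.proj_mem n w)]
      simp
  | h0 => simp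
  | hadd w₁ w₂ h₁ h₂ => simp [h₁, h₂]

theorem ext_apply {x y : M'} (h : ∀ w, (c.equiv x).1 w = (c.equiv y).1 w) : x = y :=
  c.equiv.injective (Subtype.ext (LinearMap.ext h))

theorem eq_zero_of_apply {w : M} (h : ∀ w', (c.equiv w').1 w = 0) : w = 0 :=
  M.eq_zero_of_gradedDual fun φ hφ => by simpa using h (c.equiv.symm ⟨φ, hφ⟩)

end Contragredient

namespace ModuleMap

variable {M N M' N' : TwistedModule.{u} V}

/-- The transpose of a module map as a map between contragredients. -/
def transpose (f : ModuleMap M N) (c : Contragredient M M') (d : Contragredient N N') :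
    ModuleMap N' M' where
  g_eq := by rw [c.g_eq, d.g_eq, f.g_eq]
  toLinearMap := c.equiv.symm.toLinearMap ∘ₗ
    f.gradedDualMap ∘ₗ d.equiv.toLinearMap
  map_Y n k v w' := by
    refine c.ext_apply fun w => ?_
    induction v using VertexOperatorAlgebra.induction_on with
    | hgr h v hv =>
      rw [c.formula h v hv]
      simp [d.formula h v hv, f.map_Y]
    | h0 => simp
    | hadd v₁ v₂ h₁ h₂ => simp only [map_add, LinearMap.add_apply, Submodule.coe_add, h₁, h₂]

@[simp]
theorem transpose_apply (f : ModuleMap M N) (c : Contragredient M M') (d : Contragredient N N')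
    (x : N') (w : M) :
    (c.equiv ((f.transpose c d).toLinearMap x)).1 w = (d.equiv x).1 (f.toLinearMap w) := by
  simp [transpose]

end ModuleMap

/-! ### The map into the double contragredient -/

/-- The identity `e^{-x} e^x = 1` on coefficients. -/
theorem sum_alternating_factorial_mul (N : ℕ) (F : ℕ → ℂ) (hN : 0 < N) (hF : ∀ s, N ≤ s → F s = 0) :
    ∑ i ∈ Finset.range N, ∑ j ∈ Finset.range N,
      ((-1 : ℂ) ^ i / (i.factorial : ℂ)) * (1 / (j.factorial : ℂ)) * F (i + j) = F 0 := by
  have h1 : ∀ i ∈ Finset.range N, ∑ j ∈ Finset.range N,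
      ((-1 : ℂ) ^ i / (i.factorial : ℂ)) * (1 / (j.factorial : ℂ)) * F (i + j) =
      ∑ j ∈ Finset.range (N - i),
      ((-1 : ℂ) ^ i / (i.factorial : ℂ)) * (1 / (j.factorial : ℂ)) * F (i + j) := by
    intro i _
    refine (Finset.sum_subset (Finset.range_subset_range.2 (Nat.sub_le _ _)) fun j _ hj => ?_).symm
    rw [hF _ (by simp at hj; omega), mul_zero]
  rw [Finset.sum_congr rfl h1, ← Finset.sum_range_diag_flip N fun i j =>
      ((-1 : ℂ) ^ i / (i.factorial : ℂ)) * (1 / (j.factorial : ℂ)) * F (i + j)]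
  rw [Finset.sum_eq_single 0]
  · simp
  · intro s _ hs
    have h2 : ∀ i ∈ Finset.range (s + 1),
        ((-1 : ℂ) ^ i / (i.factorial : ℂ)) * (1 / ((s - i).factorial : ℂ)) * F (i + (s - i)) =
        (F s / s.factorial) * ((-1) ^ i * 1 ^ (s - i) * s.choose i) := by
      intro i hi
      have hi' : i ≤ s := by simp at hi; omega
      rw [Nat.add_sub_cancel' hi', Nat.cast_choose ℂ hi']
      have := Nat.cast_ne_zero (R := ℂ).2 s.factorial_ne_zero
      field_simp
      simp
    rw [Finset.sum_congr rfl h2, ← Finset.mul_sum, ← add_pow]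
    simp [hs]
  · intro h; simp at h; omega

namespace Contragredient

variable {M M' M'' : TwistedModule.{u} V}

theorem flip_mem_gradedDual (c : Contragredient M M') (w : M) :
    (M.gradedDual.subtype ∘ₗ c.equiv.toLinearMap).flip w ∈ M'.gradedDual := by
  refine (M.finite_proj_ne_zero w).subset ?_
  rintro n ⟨w', hw', h⟩ h0
  refine h ?_
  have := M.apply_proj_of_vanish _ ((c.mem_gr n w').1 hw') w
  rw [h0, map_zero] at this
  exact this.symm

theorem sum_formula (c : Contragredient M M') {h : ℤ} {v : V} (hv : v ∈ gr (V := V) h) {N : ℕ}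
    (hN : ∀ i, N ≤ i → ((L V 1) ^ i : Module.End ℂ V) v = 0) (n : ℂ) (k : ℕ) (w' : M') (w : M) :
    (c.equiv (M'.Y n k v w')).1 w =
      ∑ i ∈ Finset.range N, ((-1 : ℂ) ^ h * (-1) ^ k / (Nat.factorial i : ℂ)) *
        (c.equiv w').1 (M.Y (2 * (h : ℂ) - n - 2 - i) k (((L V 1) ^ i : Module.End ℂ V) v) w) := by
  rw [c.formula h v hv]
  refine finsum_eq_finsetSum_of_support_subset _ fun i hi => ?_
  by_contra hiN
  refine hi ?_
  simp [hN i (by simpa using hiN)]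

/-- Taking the adjoint vertex operator twice gives the original vertex operator back. -/
theorem adjoint_adjoint (c : Contragredient M M') (d : Contragredient M' M'') (n : ℂ) (k : ℕ)
    (v : V) (x : M'') (w : M) (hx : ∀ w', (d.equiv x).1 w' = (c.equiv w').1 w) (w' : M') :
    (d.equiv (M''.Y n k v x)).1 w' = (c.equiv w').1 (M.Y n k v w) := by
  induction v using VertexOperatorAlgebra.induction_on with
  | hgr h v hv =>
    obtain ⟨N, hN⟩ := exists_L_one_pow_eq_zero hv
    have hN' : ∀ i j, N + 1 ≤ j → ((L V 1) ^ j : Module.End ℂ V)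
        (((L V 1) ^ i : Module.End ℂ V) v) = 0 := fun i j hj => by
      rw [← Module.End.mul_apply, ← pow_add]
      exact hN _ (by omega)
    rw [d.sum_formula hv (N := N + 1) (fun i hi => hN i (by omega))]
    -- All the terms that contain `L(1)^s v` with `s > 0` cancel.
    rw [← sub_zero n]
    have := sum_alternating_factorial_mul (N + 1)
      (fun s => (c.equiv w').1 (M.Y (n - s) k (((L V 1) ^ s : Module.End ℂ V) v) w)) (by omega)
      (fun s hs => by simp [hN s (by omega)])
    simp only [Nat.cast_zero, pow_zero, Module.End.one_apply] at this
    rw [← this]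
    refine Finset.sum_congr rfl fun i _ => ?_
    rw [hx, c.sum_formula (L_one_pow_mem hv i) (hN' i), Finset.mul_sum]
    refine Finset.sum_congr rfl fun j _ => ?_
    rw [← Module.End.mul_apply, ← pow_add, add_comm j i]
    have e : 2 * ((h - i : ℤ) : ℂ) - (2 * (h : ℂ) - (n - 0) - 2 - i) - 2 - j =
        n - (i + j : ℕ) := by push_cast; ring
    rw [e, ← mul_assoc]
    congr 1
    -- The signs: `(-1)^k (-1)^k = 1` from `log x⁻¹ = -log x`, and `(-1)^h (-1)^{h-i} = (-1)^i` from the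
    -- weights `h` of `v` and `h - i` of `L(1)^i v`.
    have h1 : ((-1 : ℂ) ^ k) * (-1) ^ k = 1 := by rw [← mul_pow]; simp
    have h2 : ((-1 : ℂ) ^ h) * (-1) ^ (h - i) = (-1) ^ i := by
      have h3 : ((-1 : ℂ) ^ (h - i)) * (-1) ^ i = (-1) ^ h := by
        rw [← zpow_natCast, ← zpow_add₀ (by norm_num)]; simp
      have h4 : ((-1 : ℂ) ^ i) * (-1) ^ i = 1 := by rw [← mul_pow]; simp
      have h5 : ((-1 : ℂ) ^ (h - i)) * (-1) ^ (h - i) = 1 := by rw [← mul_zpow]; simp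
      rw [← h3, mul_right_comm, h5, one_mul]
    calc _ = (((-1 : ℂ) ^ h) * (-1) ^ (h - i)) * (((-1 : ℂ) ^ k) * (-1) ^ k) /
          (i.factorial * j.factorial) := by ring
      _ = _ := by rw [h1, h2]; ring
  | h0 => simp
  | hadd v₁ v₂ h₁ h₂ => simp only [map_add, LinearMap.add_apply, Submodule.coe_add, h₁, h₂]

/-- The canonical module map from `M` to its double contragredient. -/
def toDouble (c : Contragredient M M') (d : Contragredient M' M'') : ModuleMap M M'' where
  g_eq := by rw [d.g_eq, c.g_eq, inv_inv]
  toLinearMap := d.equiv.symm.toLinearMap ∘ₗ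
    LinearMap.codRestrict _ (M.gradedDual.subtype ∘ₗ c.equiv.toLinearMap).flip
      c.flip_mem_gradedDual
  map_Y n k v w := by
    refine d.ext_apply fun w' => ?_
    rw [c.adjoint_adjoint d n k v _ w _ w']
    · simp
    · simp

@[simp]
theorem toDouble_apply (c : Contragredient M M') (d : Contragredient M' M'') (w : M) (w' : M') :
    (d.equiv ((c.toDouble d).toLinearMap w)).1 w' = (c.equiv w').1 w := by
  simp [toDouble]

theorem toDouble_injective (c : Contragredient M M') (d : Contragredient M' M'') :
    Function.Injective (c.toDouble d).toLinearMap := by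
  rw [injective_iff_map_eq_zero]
  intro w hw
  refine c.eq_zero_of_apply fun w' => ?_
  rw [← c.toDouble_apply d, hw]
  simp

/-- The weight spaces of the contragredient are the duals of the weight spaces. -/
def grEquiv (c : Contragredient M M') (n : ℂ) : M'.gr n ≃ₗ[ℂ] Module.Dual ℂ (M.gr n) :=
  LinearEquiv.ofBijective
    ((M.gr n).subtype.dualMap ∘ₗ M.gradedDual.subtype ∘ₗ c.equiv.toLinearMap ∘ₗ
      (M'.gr n).subtype) (by
    constructor
    · rw [injective_iff_map_eq_zero]
      rintro ⟨x, hx⟩ h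
      refine Subtype.ext (c.ext_apply fun w => ?_)
      rw [← M.apply_proj_of_vanish _ ((c.mem_gr n x).1 hx) w]
      simpa using LinearMap.congr_fun h ⟨_, M.proj_mem n w⟩
    · intro ψ
      obtain ⟨φ, hφ⟩ := ψ.exists_extend
      have hv : ∀ m, m ≠ n → ∀ w ∈ M.gr m, (φ ∘ₗ M.proj n) w = 0 := fun m hm w hw => by
        simp [M.proj_of_ne hm hw]
      refine ⟨⟨c.equiv.symm ⟨_, M.comp_proj_mem_gradedDual n φ⟩, (c.mem_gr n _).2 ?_⟩, ?_⟩
      · simpa using hv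
      · ext w
        simp [M.proj_of_mem w.2, ← hφ])

/-- An injective module map from the double contragredient to `M` embeds the double dual of each weight
space into the weight space itself, which is impossible in infinite dimension. -/
theorem finiteDimensional_gr (c : Contragredient M M') (d : Contragredient M' M'')
    (f : ModuleMap M'' M) (hf : Function.Injective f.toLinearMap) (n : ℂ) :
    FiniteDimensional ℂ (M.gr n) := by
  by_contra hfin
  have h1 : Cardinal.aleph0 ≤ Module.rank ℂ (M.gr n) := by
    rw [← not_lt]
    exact fun h => hfin (Module.rank_lt_aleph0_iff.1 h)
  -- An infinite-dimensional space is strictly smaller than its dual.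
  have h2 : Module.rank ℂ (M.gr n) < Module.rank ℂ (M'.gr n) := by
    have := lift_rank_lt_rank_dual h1
    rw [← (c.grEquiv n).rank_eq] at this
    simpa using this
  have h3 : Module.rank ℂ (M'.gr n) < Module.rank ℂ (M''.gr n) := by
    have := lift_rank_lt_rank_dual (h1.trans h2.le)
    rw [← (d.grEquiv n).rank_eq] at this
    simpa using this
  refine (h2.trans h3).not_ge ?_
  refine LinearMap.rank_le_of_injective
    (f.toLinearMap.restrict (p := M''.gr n) (q := M.gr n) fun _ h => f.map_gr h) ?_
  intro x y hxy
  exact Subtype.ext (hf (congrArg Subtype.val hxy))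

theorem toDouble_bijective (c : Contragredient M M') (d : Contragredient M' M'')
    (hfin : ∀ n, FiniteDimensional ℂ (M.gr n)) :
    Function.Bijective (c.toDouble d).toLinearMap := by
  refine ⟨c.toDouble_injective d, LinearMap.range_eq_top.1 (top_unique ?_)⟩
  rw [← M''.internal.submodule_iSup_eq_top]
  refine iSup_le fun n x hx => ?_
  have := hfin n
  have : FiniteDimensional ℂ (M'.gr n) := (c.grEquiv n).symm.finiteDimensional
  have : FiniteDimensional ℂ (M''.gr n) := (d.grEquiv n).symm.finiteDimensional
  have hrank : Module.finrank ℂ (M.gr n) = Module.finrank ℂ (M''.gr n) := by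
    rw [(d.grEquiv n).finrank_eq, Subspace.dual_finrank_eq, (c.grEquiv n).finrank_eq,
      Subspace.dual_finrank_eq]
  have hinj : Function.Injective ((c.toDouble d).toLinearMap.restrict (p := M.gr n)
      (q := M''.gr n) fun _ h => (c.toDouble d).map_gr h) := fun x y hxy =>
    Subtype.ext (c.toDouble_injective d (congrArg Subtype.val hxy))
  obtain ⟨y, hy⟩ :=
    (LinearMap.injective_iff_surjective_of_finrank_eq_finrank hrank).1 hinj ⟨x, hx⟩
  exact ⟨y, congrArg Subtype.val hy⟩

end Contragredient

/-! ### Intertwining maps and module maps -/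

/-- The bilinear map `𝒴(f₁(·), x) f₂(·)` is a twisted intertwining operator for module maps `f₁` and
`f₂`, as these commute with vertex operators and with the projections to weight spaces. -/
theorem IsTwistedIntertwining.comp {M₁ M₂ N₁ N₂ M₃ : TwistedModule.{u} V}
    {𝒴 : ℂ → ℕ → N₁ →ₗ[ℂ] N₂ →ₗ[ℂ] M₃} (h : IsTwistedIntertwining N₁ N₂ M₃ 𝒴)
    (f₁ : ModuleMap M₁ N₁) (f₂ : ModuleMap M₂ N₂) :
    IsTwistedIntertwining M₁ M₂ M₃
      (fun n k => (𝒴 n k).compl₁₂ f₁.toLinearMap f₂.toLinearMap) where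
  log_series := ⟨fun _ _ => h.log_series.log_bounded _ _,
    fun _ _ => h.log_series.weight_finite _ _⟩
  lower_truncation _ _ := h.lower_truncation _ _
  duality a w₁ w₂ φ hφ := by
    simpa only [LinearMap.compl₁₂_apply, f₁.map_proj, f₂.map_proj, f₁.map_Y, f₂.map_Y] using
      h.duality a (f₁.toLinearMap w₁) (f₂.toLinearMap w₂) φ hφ
  convergence d hd a _ _ φ hφ := h.convergence d hd a _ _ φ hφ
  L_neg_one n k w₁ w₂ := by
    simpa only [LinearMap.compl₁₂_apply, f₁.map_Y] using h.L_neg_one n k _ _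

theorem IsPzIntertwiningMap.comp {z : ℂ} {M₁ M₂ N₁ N₂ M₃ : TwistedModule.{u} V}
    {I : N₁ ⊗[ℂ] N₂ →ₗ[ℂ] M₃.Completion} (h : IsPzIntertwiningMap z N₁ N₂ M₃ I)
    (f₁ : ModuleMap M₁ N₁) (f₂ : ModuleMap M₂ N₂) :
    IsPzIntertwiningMap z M₁ M₂ M₃ (I ∘ₗ TensorProduct.map f₁.toLinearMap f₂.toLinearMap) := by
  obtain ⟨hg, 𝒴, h𝒴, hI⟩ := h
  refine ⟨by rw [hg, f₁.g_eq, f₂.g_eq], _, h𝒴.comp f₁ f₂, fun w₁ w₂ m => ?_⟩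
  rw [LinearMap.comp_apply, TensorProduct.map_tmul, hI]
  rfl

namespace TwistedCategory

variable {G : Subgroup (Aut V)} {C : TwistedCategory.{u} G} {z : ℂ} {W₁ W₂ W₁' W₂' : C.Obj}

/-! ### Module maps into `W₁ ⧅ W₂` -/

/-- The linear map `w' ↦ λ_{I, w'}` for a `P(z)`-product `(W₃, I)`. -/
def hboxtrOfProduct {W₃ : C.Obj} {I : C.mod W₁ ⊗[ℂ] C.mod W₂ →ₗ[ℂ] (C.mod W₃).Completion}
    (hI : IsPzIntertwiningMap z (C.mod W₁) (C.mod W₂) (C.mod W₃) I) :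
    (C.mod W₃).gradedDual →ₗ[ℂ] C.hboxtr z W₁ W₂ :=
  LinearMap.codRestrict _ (LinearMap.lcomp ℂ ℂ I ∘ₗ (C.mod W₃).pairingₗ)
    fun φ => Submodule.subset_span ⟨W₃, I, hI, φ, fun _ => rfl⟩

@[simp]
theorem hboxtrOfProduct_apply {W₃ : C.Obj}
    {I : C.mod W₁ ⊗[ℂ] C.mod W₂ →ₗ[ℂ] (C.mod W₃).Completion}
    (hI : IsPzIntertwiningMap z (C.mod W₁) (C.mod W₂) (C.mod W₃) I) (φ : (C.mod W₃).gradedDual)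
    (t : C.mod W₁ ⊗[ℂ] C.mod W₂) :
    (hboxtrOfProduct hI φ).1 t = (C.mod W₃).pairing φ (I t) := rfl

namespace HboxtrModule

variable {H : TwistedModule.{u} V}

theorem ext_apply (s : C.HboxtrModule z W₁ W₂ H) {x y : H}
    (h : ∀ t, (s.equiv x).1 t = (s.equiv y).1 t) : x = y :=
  s.equiv.injective (Subtype.ext (LinearMap.ext h))

/-- For a `P(z)`-product `(W₃, I)`, the module map `w' ↦ λ_{I, w'}` from `W₃'` to `W₁ ⧅ W₂`. -/
def ofProduct (s : C.HboxtrModule z W₁ W₂ H) {W₃ : C.Obj}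
    {I : C.mod W₁ ⊗[ℂ] C.mod W₂ →ₗ[ℂ] (C.mod W₃).Completion}
    (hI : IsPzIntertwiningMap z (C.mod W₁) (C.mod W₂) (C.mod W₃) I)
    {M' : TwistedModule.{u} V} (c : Contragredient (C.mod W₃) M') : ModuleMap M' H where
  g_eq := by rw [c.g_eq, s.g_eq, hI.1]
  toLinearMap := s.equiv.symm.toLinearMap ∘ₗ hboxtrOfProduct hI ∘ₗ c.equiv.toLinearMap
  map_Y n k v w' := by
    refine s.ext_apply fun t => ?_
    refine Eq.trans ?_ ((s.compat W₃ I hI M' c w' _ fun t => ?_).2 n k v t).symm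
    · simp
    · simp

theorem ofProduct_apply (s : C.HboxtrModule z W₁ W₂ H) {W₃ : C.Obj}
    {I : C.mod W₁ ⊗[ℂ] C.mod W₂ →ₗ[ℂ] (C.mod W₃).Completion}
    (hI : IsPzIntertwiningMap z (C.mod W₁) (C.mod W₂) (C.mod W₃) I)
    {M' : TwistedModule.{u} V} (c : Contragredient (C.mod W₃) M') (w' : M')
    (t : C.mod W₁ ⊗[ℂ] C.mod W₂) :
    (s.equiv ((s.ofProduct hI c).toLinearMap w')).1 t = (C.mod W₃).pairing (c.equiv w') (I t) := by
  simp [ofProduct]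

end HboxtrModule

/-- The subspaces `W₁ ⧅ W₂` are compatible with `f₁ ⊗ f₂`, since
`λ_{I, w'} ∘ (f₁ ⊗ f₂) = λ_{I ∘ (f₁ ⊗ f₂), w'}`. -/
theorem comp_map_mem_hboxtr (f₁ : W₁ ⟶ W₁') (f₂ : W₂ ⟶ W₂')
    {l : Module.Dual ℂ (C.mod W₁' ⊗[ℂ] C.mod W₂')} (hl : l ∈ C.hboxtr z W₁' W₂') :
    l ∘ₗ TensorProduct.map f₁.toLinearMap f₂.toLinearMap ∈ C.hboxtr z W₁ W₂ := by
  induction hl using Submodule.span_induction with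
  | mem l h =>
    obtain ⟨W₃, I, hI, φ, hl⟩ := h
    exact Submodule.subset_span ⟨W₃, _, hI.comp f₁ f₂, φ, fun t => hl _⟩
  | zero => simp
  | add l₁ l₂ _ _ h₁ h₂ =>
    rw [LinearMap.add_comp]
    exact add_mem h₁ h₂
  | smul a l _ h =>
    rw [LinearMap.smul_comp]
    exact Submodule.smul_mem _ _ h

/-- The map `λ ↦ λ ∘ (f₁ ⊗ f₂)`. -/
def hboxtrMap (z : ℂ) (f₁ : W₁ ⟶ W₁') (f₂ : W₂ ⟶ W₂') :
    C.hboxtr z W₁' W₂' →ₗ[ℂ] C.hboxtr z W₁ W₂ :=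
  LinearMap.codRestrict _ ((TensorProduct.map f₁.toLinearMap f₂.toLinearMap).dualMap ∘ₗ
    (C.hboxtr z W₁' W₂').subtype) fun l => comp_map_mem_hboxtr f₁ f₂ l.2

@[simp]
theorem hboxtrMap_apply (f₁ : W₁ ⟶ W₁') (f₂ : W₂ ⟶ W₂') (l : C.hboxtr z W₁' W₂')
    (t : C.mod W₁ ⊗[ℂ] C.mod W₂) :
    (hboxtrMap z f₁ f₂ l).1 t = l.1 (TensorProduct.map f₁.toLinearMap f₂.toLinearMap t) := rfl

/-- The module map `λ ↦ λ ∘ (f₁ ⊗ f₂)` from `W₁' ⧅ W₂'` to `W₁ ⧅ W₂`. -/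
def HboxtrModule.map (hC : C.TensorAssumption z) {H H' : TwistedModule.{u} V}
    (s : C.HboxtrModule z W₁ W₂ H) (s' : C.HboxtrModule z W₁' W₂' H')
    (f₁ : W₁ ⟶ W₁') (f₂ : W₂ ⟶ W₂') : ModuleMap H' H where
  g_eq := by rw [s.g_eq, s'.g_eq, f₁.g_eq, f₂.g_eq]
  toLinearMap := s.equiv.symm.toLinearMap ∘ₗ hboxtrMap z f₁ f₂ ∘ₗ s'.equiv.toLinearMap
  map_Y n k v x := by
    obtain ⟨⟨l, hl⟩, rfl⟩ := s'.equiv.symm.surjective x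
    induction hl using Submodule.span_induction with
    | mem l h =>
      obtain ⟨W₃, I, hI, φ, hl⟩ := h
      obtain ⟨M', ⟨c⟩⟩ := hC.contragredient_mem W₃
      obtain ⟨w', rfl⟩ := c.equiv.surjective φ
      refine s.ext_apply fun t => ?_
      refine Eq.trans ?_ ((s.compat W₃ _ (hI.comp f₁ f₂) _ c w' _ fun t => ?_).2 n k v t).symm
      · simp only [LinearMap.comp_apply, LinearEquiv.coe_coe, LinearEquiv.apply_symm_apply,
          hboxtrMap_apply]
        exact (s'.compat W₃ I hI _ c w' _ fun t => by simpa using hl t).2 n k v _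
      · simpa using hl _
    | zero =>
      rw [show (⟨0, _⟩ : C.hboxtr z W₁' W₂') = 0 from rfl]
      simp only [map_zero]
    | add l₁ l₂ hl₁ hl₂ h₁ h₂ =>
      have e : (⟨l₁ + l₂, add_mem hl₁ hl₂⟩ : C.hboxtr z W₁' W₂') = ⟨l₁, hl₁⟩ + ⟨l₂, hl₂⟩ := rfl
      rw [e]
      simp only [map_add, h₁, h₂]
    | smul a l hl h =>
      have e : (⟨a • l, Submodule.smul_mem _ a hl⟩ : C.hboxtr z W₁' W₂') = a • ⟨l, hl⟩ := rfl
      rw [e]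
      simp only [map_smul, h]

theorem HboxtrModule.map_apply (hC : C.TensorAssumption z) {H H' : TwistedModule.{u} V}
    (s : C.HboxtrModule z W₁ W₂ H) (s' : C.HboxtrModule z W₁' W₂' H')
    (f₁ : W₁ ⟶ W₁') (f₂ : W₂ ⟶ W₂') (x : H') (t : C.mod W₁ ⊗[ℂ] C.mod W₂) :
    (s.equiv ((s.map hC s' f₁ f₂).toLinearMap x)).1 t =
      (s'.equiv x).1 (TensorProduct.map f₁.toLinearMap f₂.toLinearMap t) := by
  simp [HboxtrModule.map]

/-! ### The tensor product -/

/-- The canonical map from an object of the category to any double contragredient is bijective: an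
abstract equivalence with the double contragredient forces the weight spaces to be
finite-dimensional. -/
theorem TensorAssumption.toDouble_bijective (hC : C.TensorAssumption z) {W : C.Obj}
    {M' M'' : TwistedModule.{u} V} (c : Contragredient (C.mod W) M') (d : Contragredient M' M'') :
    Function.Bijective (c.toDouble d).toLinearMap := by
  obtain ⟨f, hf⟩ := hC.double_contragredient W M' M'' c d
  exact c.toDouble_bijective d (c.finiteDimensional_gr d f hf.1)

namespace TensorObj

/-- The defining property `⟨λ, w₁ ⊠ w₂⟩ = λ(w₁ ⊗ w₂)` in each weight. -/
theorem contra_boxtimes (T : C.TensorObj z W₁ W₂) (t : C.mod W₁ ⊗[ℂ] C.mod W₂) (n : ℂ)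
    (x : C.mod T.hbox) :
    (T.contra.equiv (T.boxtimes t n : C.mod T.obj)).1 x =
      (T.hbox_str.equiv ((C.mod T.hbox).proj n x)).1 t := by
  simp [boxtimes, evalAt]

/-- A module map out of `W₁ ⊠ W₂` is determined by its values on the components of the elements
`w₁ ⊠ w₂`: composed with a functional in the graded dual it is the evaluation at an
element of `W₁ ⧅ W₂`, and such an element is a functional on `W₁ ⊗ W₂`. -/
theorem hom_ext (hC : C.TensorAssumption z) (T : C.TensorObj z W₁ W₂) {W₃ : C.Obj}
    {f g : T.obj ⟶ W₃}
    (h : ∀ t n, f.toLinearMap (T.boxtimes t n : C.mod T.obj) = g.toLinearMap (T.boxtimes t n)) :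
    f = g := by
  obtain ⟨_, ⟨c⟩⟩ := hC.contragredient_mem W₃
  obtain ⟨_, ⟨d⟩⟩ := hC.contragredient_mem T.obj
  have hbij := hC.toDouble_bijective T.contra d
  refine ModuleMap.ext (LinearMap.ext fun u => sub_eq_zero.1 (c.eq_zero_of_apply fun w' => ?_))
  -- The functionals `w' ∘ f` and `w' ∘ g` are the evaluations at some `x` and `y`.
  obtain ⟨x, hx⟩ := hbij.2 ((ModuleMap.transpose f d c).toLinearMap w')
  obtain ⟨y, hy⟩ := hbij.2 ((ModuleMap.transpose g d c).toLinearMap w')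
  have hfx : ∀ u, (c.equiv w').1 (f.toLinearMap u) = (T.contra.equiv u).1 x := fun u => by
    rw [← T.contra.toDouble_apply d, hx, ModuleMap.transpose_apply]
  have hgy : ∀ u, (c.equiv w').1 (g.toLinearMap u) = (T.contra.equiv u).1 y := fun u => by
    rw [← T.contra.toDouble_apply d, hy, ModuleMap.transpose_apply]
  have hxy : x - y = 0 := (C.mod T.hbox).eq_zero_of_proj_eq_zero fun n => by
    rw [map_sub, sub_eq_zero]
    refine T.hbox_str.ext_apply fun t => ?_
    rw [← T.contra_boxtimes, ← T.contra_boxtimes, ← hfx, ← hgy, h]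
  rw [map_sub, hfx, hgy, sub_eq_zero.1 hxy, sub_self]

/-- The map is the transpose of `w' ↦ λ_{I, w'}` followed by the identification of `W₃''` with
`W₃`. -/
theorem exists_factors (hC : C.TensorAssumption z) (T : C.TensorObj z W₁ W₂) {W₃ : C.Obj}
    {I : C.mod W₁ ⊗[ℂ] C.mod W₂ →ₗ[ℂ] (C.mod W₃).Completion}
    (hI : IsPzIntertwiningMap z (C.mod W₁) (C.mod W₂) (C.mod W₃) I) :
    ∃ f : T.obj ⟶ W₃, T.Factors I f := by
  obtain ⟨W', ⟨c⟩⟩ := hC.contragredient_mem W₃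
  obtain ⟨_, ⟨d⟩⟩ := hC.contragredient_mem W'
  have hbij := hC.toDouble_bijective c d
  let p := T.hbox_str.ofProduct hI c
  let f : T.obj ⟶ W₃ := CategoryTheory.CategoryStruct.comp (obj := TwistedModule.{u} V)
    (p.transpose d T.contra) ((c.toDouble d).inverse hbij)
  refine ⟨f, fun t n => ?_⟩
  -- In `W₃''` the components of `w₁ ⊠ w₂` and of `I(w₁ ⊗ w₂)` have the same image.
  have key : (p.transpose d T.contra).toLinearMap (T.boxtimes t n : C.mod T.obj) =
      (c.toDouble d).toLinearMap (I t n : C.mod W₃) := by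
    refine d.ext_apply fun w' => ?_
    rw [ModuleMap.transpose_apply, contra_boxtimes, ← p.map_proj, HboxtrModule.ofProduct_apply,
      c.toDouble_apply,
      (C.mod W₃).pairing_of_vanish _ ((c.mem_gr n _).1 ((C.mod W').proj_mem n w')), c.apply_proj,
      (C.mod W₃).proj_of_mem (I t n).2]
  change ((c.toDouble d).inverse hbij).toLinearMap ((p.transpose d T.contra).toLinearMap _) = _
  rw [key, ModuleMap.inverse_apply]

/-- The tensor product `f₁ ⊠ f₂`, the transpose of `λ ↦ λ ∘ (f₁ ⊗ f₂)`. -/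
def map (hC : C.TensorAssumption z) (T : C.TensorObj z W₁ W₂) (T' : C.TensorObj z W₁' W₂')
    (f₁ : W₁ ⟶ W₁') (f₂ : W₂ ⟶ W₂') : T.obj ⟶ T'.obj :=
  (T.hbox_str.map hC T'.hbox_str f₁ f₂).transpose T'.contra T.contra

theorem factors_map (hC : C.TensorAssumption z) (T : C.TensorObj z W₁ W₂)
    (T' : C.TensorObj z W₁' W₂') (f₁ : W₁ ⟶ W₁') (f₂ : W₂ ⟶ W₂') :
    T.Factors (T'.boxtimesComp f₁ f₂) (T.map hC T' f₁ f₂) := by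
  intro t n
  refine T'.contra.ext_apply fun x => ?_
  change (T'.contra.equiv (ModuleMap.toLinearMap (ModuleMap.transpose _ _ _) _)).1 x =
    (T'.contra.equiv (T'.boxtimes _ n : C.mod T'.obj)).1 x
  rw [ModuleMap.transpose_apply, contra_boxtimes, contra_boxtimes, ← ModuleMap.map_proj,
    HboxtrModule.map_apply]

theorem eq_of_factors (hC : C.TensorAssumption z) (T : C.TensorObj z W₁ W₂) {W₃ : C.Obj}
    {I : C.mod W₁ ⊗[ℂ] C.mod W₂ →ₗ[ℂ] (C.mod W₃).Completion} {f g : T.obj ⟶ W₃}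
    (hf : T.Factors I f) (hg : T.Factors I g) : f = g :=
  T.hom_ext hC fun t n => (hf t n).trans (hg t n).symm

end TensorObj

end TwistedCategory

end

theorem mainTheorem11 {V : Type v} [AddCommGroup V] [Module ℂ V] [VertexOperatorAlgebra V]
    (G : Subgroup (VertexOperatorAlgebra.Aut V)) (C : TwistedCategory.{u} G) (z : ℂ) (hz : z ≠ 0)
    (hC : C.TensorAssumption z) :
    (∀ W₁ W₂ : C.Obj, Nonempty (C.TensorObj z W₁ W₂)) ∧
    ∀ T : (W₁ W₂ : C.Obj) → C.TensorObj z W₁ W₂,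
      (∀ (W₁ W₂ W₃ : C.Obj) (I : C.mod W₁ ⊗[ℂ] C.mod W₂ →ₗ[ℂ] (C.mod W₃).Completion),
        IsPzIntertwiningMap z (C.mod W₁) (C.mod W₂) (C.mod W₃) I →
          ∃! f : (T W₁ W₂).obj ⟶ W₃, (T W₁ W₂).Factors I f) ∧
      ∃ tensorMap : {W₁ W₁' W₂ W₂' : C.Obj} → (W₁ ⟶ W₁') → (W₂ ⟶ W₂') →
          ((T W₁ W₂).obj ⟶ (T W₁' W₂').obj),
        (∀ {W₁ W₁' W₂ W₂' : C.Obj} (f₁ : W₁ ⟶ W₁') (f₂ : W₂ ⟶ W₂')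
          (f : (T W₁ W₂).obj ⟶ (T W₁' W₂').obj),
          (T W₁ W₂).Factors ((T W₁' W₂').boxtimesComp f₁ f₂) f ↔ f = tensorMap f₁ f₂) ∧
        ∃ F : CategoryTheory.Functor (C.Obj × C.Obj) C.Obj,
          F.toPrefunctor =
            { obj := fun W => (T W.1 W.2).obj
              map := fun f => tensorMap f.1 f.2 } := by
  refine ⟨fun W₁ W₂ => ?_, fun T => ⟨fun W₁ W₂ W₃ I hI => ?_, ?_⟩⟩
  · obtain ⟨H, ⟨s⟩⟩ := hC.hboxtr_mem W₁ W₂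
    obtain ⟨W, ⟨c⟩⟩ := hC.contragredient_mem H
    exact ⟨⟨H, s, W, c⟩⟩
  · obtain ⟨f, hf⟩ := (T W₁ W₂).exists_factors hC hI
    exact ⟨f, hf, fun g hg => (T W₁ W₂).eq_of_factors hC hg hf⟩
  refine ⟨fun f₁ f₂ => (T _ _).map hC (T _ _) f₁ f₂, fun f₁ f₂ f => ⟨fun h =>
    (T _ _).eq_of_factors hC h ((T _ _).factors_map hC _ f₁ f₂), fun h => h ▸
    (T _ _).factors_map hC _ f₁ f₂⟩, ⟨{
      obj := fun W => (T W.1 W.2).obj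
      map := fun f => (T _ _).map hC (T _ _) f.1 f.2
      map_id := fun W => ?_
      map_comp := fun {X Y Z} f g => ?_ }, rfl⟩⟩
  · refine (T _ _).eq_of_factors hC ((T _ _).factors_map hC _ _ _) fun t n => ?_
    change _ = (((T W.1 W.2).boxtimes (TensorProduct.map LinearMap.id LinearMap.id t) n :
      (C.mod (T W.1 W.2).obj).gr n) : C.mod (T W.1 W.2).obj)
    rw [TensorProduct.map_id]
    rfl
  · refine (T _ _).eq_of_factors hC ((T _ _).factors_map hC _ _ _) fun t n => ?_
    change ((T Y.1 Y.2).map hC (T Z.1 Z.2) g.1 g.2).toLinearMap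
        (((T X.1 X.2).map hC (T Y.1 Y.2) f.1 f.2).toLinearMap _) =
      (((T Z.1 Z.2).boxtimes (TensorProduct.map (g.1.toLinearMap ∘ₗ f.1.toLinearMap)
        (g.2.toLinearMap ∘ₗ f.2.toLinearMap) t) n : (C.mod (T Z.1 Z.2).obj).gr n) :
        C.mod (T Z.1 Z.2).obj)
    rw [(T X.1 X.2).factors_map hC _ _ _ t n, TensorProduct.map_comp]
    exact (T Y.1 Y.2).factors_map hC _ _ _ _ n
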